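/- **Setting.** Let $n\ge 1$ and let $H:\mathbb R^n\times\mathbb R^n\to\mathbb R$, $H=H(p,y)$, be such that $p\mapsto H(p,y)$ is convex for every $y\in\mathbb R^n$; $\lim_{|p|\to\infty}\inf_{y\in\mathbb R^n}H(p,y)=+\infty$; and for every $R>0$, $H$ is uniformly continuous and bounded on $B_R\times\mathbb R^n$, where $B_R$ is the open ball of radius $R$ centered at $0$. Sub- and supersolutions of $$H(p+Du,y)=\mu \qquad (\ast)$$ are understood in the viscosity sense. For $p\in\mathbb R^n$ let $\overline H(p)$ be the infimum of all $\mu\in\mathbb R$ for which there is a globally Lipschitz function $w:\mathbb R^n\to\mathbb R$ that is a subsolution of $(\ast)$ in $\mathbb R^n$ and satisfies $\lim_{|y|\to\infty}|y|^{-1}w(y)=0$. **Proposition.** Let $p\in\mathbb R^n$, $\mu>\overline H(p)$, and let $D\subseteq\mathbb R^n$ be compact. Suppose that $u:\overline{\mathbb R^n\setminus D}\to\mathbb R$ is upper semicontinuous and a subsolution of $(\ast)$ in $\mathbb R^n\setminus D$, that $v:\overline{\mathbb R^n\setminus D}\to\mathbb R$ is lower semicontinuous and a supersolution of $(\ast)$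 in $\mathbb R^n\setminus D$, and that $$\liminf_{|x|\to\infty}\frac{v(x)}{|x|}>0\qquad\text{and}\qquad \limsup_{|x|\to\infty}\frac{u(x)}{|x|}<\infty .$$ Then $$\sup_{\overline{\mathbb R^n\setminus D}}(u-v)=\sup_{\partial D}(u-v)$$ (equivalently, $u-v\le\sup_{\partial D}(u-v)$ in $\mathbb R^n\setminus D$). If, moreover, $u-v$ is continuous up to $\partial D$, i.e. $(u-v)(y)\to(u-v)(x)$ as $y\to x$ with $y\in\mathbb R^n\setminus D$ for every $x\in\partial D$, then $$\sup_{\mathbb R^n\setminus D}(u-v)=\sup_{\partial D}(u-v).$$ Suprema are taken in $[-\infty,\infty]$, with $\sup\emptyset=-\infty$. -/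

import Mathlib

open Filter Topology Bornology
open scoped NNReal

noncomputable section

namespace Eikonal

/-- The Hamiltonian `H = H(p, y)` is convex in `p`, coercive in `p` uniformly in `y`
(that is, `inf_y H(p, y) → +∞` as `|p| → ∞`), and uniformly continuous and bounded on
`B_R × ℝⁿ` for every `R > 0`. -/
structure IsAdmissible {n : ℕ}
    (H : EuclideanSpace ℝ (Fin n) → EuclideanSpace ℝ (Fin n) → ℝ) : Prop where
  convex : ∀ y, ConvexOn ℝ Set.univ (fun p => H p y)
  coercive : ∀ M : ℝ, ∃ R : ℝ, ∀ p, R ≤ ‖p‖ → ∀ y, M ≤ H p y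
  uniformContinuousOn : ∀ R : ℝ, 0 < R →
    UniformContinuousOn
      (fun z : EuclideanSpace ℝ (Fin n) × EuclideanSpace ℝ (Fin n) => H z.1 z.2)
      (Metric.ball 0 R ×ˢ Set.univ)
  bounded : ∀ R : ℝ, 0 < R → ∃ C : ℝ, ∀ p ∈ Metric.ball (0 : EuclideanSpace ℝ (Fin n)) R,
    ∀ y, |H p y| ≤ C

/-- `H(p + Du, y) ≤ μ` in `U` in the viscosity sense: the inequality holds for `Dφ` at every
point `x ∈ U` where `u - φ` has a local maximum, `φ` being a `C¹` test function.
Semicontinuity of `u` is stated separately where it is needed. -/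
def ViscSubsol {n : ℕ} (H : EuclideanSpace ℝ (Fin n) → EuclideanSpace ℝ (Fin n) → ℝ)
    (p : EuclideanSpace ℝ (Fin n)) (μ : ℝ) (U : Set (EuclideanSpace ℝ (Fin n)))
    (u : EuclideanSpace ℝ (Fin n) → ℝ) : Prop :=
  ∀ φ : EuclideanSpace ℝ (Fin n) → ℝ, ContDiff ℝ 1 φ → ∀ x ∈ U,
    IsLocalMaxOn (fun y => u y - φ y) U x → H (p + gradient φ x) x ≤ μ

/-- `H(p + Dv, y) ≥ μ` in `U` in the viscosity sense: the inequality holds for `Dφ` at every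
point `x ∈ U` where `v - φ` has a local minimum, `φ` being a `C¹` test function. -/
def ViscSupersol {n : ℕ} (H : EuclideanSpace ℝ (Fin n) → EuclideanSpace ℝ (Fin n) → ℝ)
    (p : EuclideanSpace ℝ (Fin n)) (μ : ℝ) (U : Set (EuclideanSpace ℝ (Fin n)))
    (v : EuclideanSpace ℝ (Fin n) → ℝ) : Prop :=
  ∀ φ : EuclideanSpace ℝ (Fin n) → ℝ, ContDiff ℝ 1 φ → ∀ x ∈ U,
    IsLocalMinOn (fun y => v y - φ y) U x → μ ≤ H (p + gradient φ x) x

/-- The effective Hamiltonian: the infimum of the `μ` for which `H(p + Dw, y) ≤ μ` in `ℝⁿ` has a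
(globally) Lipschitz viscosity solution `w` that is strictly sublinear at infinity.
For admissible `H` and `n ≥ 1` the set is nonempty and bounded below. -/
def effectiveH {n : ℕ} (H : EuclideanSpace ℝ (Fin n) → EuclideanSpace ℝ (Fin n) → ℝ)
    (p : EuclideanSpace ℝ (Fin n)) : ℝ :=
  sInf {μ : ℝ | ∃ w : EuclideanSpace ℝ (Fin n) → ℝ,
    (∃ K : ℝ≥0, LipschitzWith K w) ∧
    ViscSubsol H p μ Set.univ w ∧
    Tendsto (fun y => w y / ‖y‖) (cobounded (EuclideanSpace ℝ (Fin n))) (𝓝 0)}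

end Eikonal

end

/-
The smooth minimum `softMin u (w + C)` of a subsolution `u` and a strict, sublinear subsolution
`w + C` is again a strict subsolution, because by convexity of `H` its gradient is a convex
combination of `Du` and `Dw`. It is at most `w + C`, and `w + C - v → -∞` at
infinity, so `softMin u (w + C) - v` attains its maximum over the closed exterior domain, and
strictness forces a maximum point onto the boundary. There `softMin u (w + C) ≤ u`, and `C → ∞`
recovers `u`.

To test `u`, `w` and `v`, which are only semicontinuous, simultaneously, the three variables are
separated and quadratic penalties are added.
-/

namespace Eikonal

section Semicontinuity

variable {α : Type*} [TopologicalSpace α] {s : Set α} {f g : α → ℝ}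

theorem upperSemicontinuousOn_sub (hf : UpperSemicontinuousOn f s)
    (hg : LowerSemicontinuousOn g s) : UpperSemicontinuousOn (fun x => f x - g x) s := by
  simpa only [sub_eq_add_neg] using!
    hf.add (continuous_neg.comp_lowerSemicontinuousOn_antitone hg fun _ _ => neg_le_neg)

theorem exists_isMaxOn_of_eventually_le (hf : UpperSemicontinuousOn f s) (hs : IsClosed s)
    {a : α} (ha : a ∈ s) (hle : ∀ᶠ x in cocompact α ⊓ 𝓟 s, f x ≤ f a) :
    ∃ x ∈ s, IsMaxOn f s x := by
  obtain ⟨K, hK, hKf⟩ := (hasBasis_cocompact.inf_principal s).eventually_iff.1 hle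
  have hsub : insert a (K ∩ s) ⊆ s := Set.insert_subset ha Set.inter_subset_right
  obtain ⟨x, hx, hmax⟩ := (hf.mono hsub).exists_isMaxOn (Set.insert_nonempty _ _)
    ((hK.inter_right hs).insert a)
  refine ⟨x, hsub hx, fun y hy => ?_⟩
  by_cases hyK : y ∈ K
  · exact hmax (Or.inr ⟨hyK, hy⟩)
  · exact (hKf ⟨hyK, hy⟩).trans (hmax (Or.inl rfl))

theorem eventually_forall_sub_mul_lt {K : Set α} (hK : IsCompact K) {G Q : α → ℝ}
    (hG : UpperSemicontinuousOn G K) (hQ : LowerSemicontinuousOn Q K) (hQ0 : ∀ X ∈ K, 0 ≤ Q X)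
    {m : ℝ} (hm : ∀ X ∈ K, Q X = 0 → G X < m) :
    ∀ᶠ k : ℝ in atTop, ∀ X ∈ K, G X - k * Q X < m := by
  refine hK.induction_on (p := fun s => ∀ᶠ k : ℝ in atTop, ∀ X ∈ s, G X - k * Q X < m)
    (by simp) (fun s t hst ht => ht.mono fun k hk X hX => hk X (hst hX))
    (fun s t hs ht => (hs.and ht).mono fun k hk X hX => hX.elim (hk.1 X) (hk.2 X)) fun X hX => ?_
  rcases (hQ0 X hX).eq_or_lt with hQX | hQX
  · refine ⟨{Y | G Y < m} ∩ K, inter_mem (hG X hX m (hm X hX hQX.symm)) self_mem_nhdsWithin, ?_⟩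
    filter_upwards [eventually_ge_atTop 0] with k hk Y ⟨hGY, hY⟩
    exact (sub_le_self _ (mul_nonneg hk (hQ0 Y hY))).trans_lt hGY
  · refine ⟨{Y | G Y < G X + 1} ∩ {Y | Q X / 2 < Q Y},
      inter_mem (hG X hX _ (lt_add_one _)) (hQ X hX _ (half_lt_self hQX)), ?_⟩
    have hlarge : ∀ᶠ k : ℝ in atTop, G X + 1 - m < k * (Q X / 2) :=
      (tendsto_id.atTop_mul_const (half_pos hQX)).eventually_gt_atTop _
    filter_upwards [hlarge, eventually_ge_atTop 0] with k hk hk0 Y ⟨hGY, hQY⟩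
    have hGY : G Y < G X + 1 := hGY
    linarith [mul_le_mul_of_nonneg_left (le_of_lt hQY) hk0]

theorem biSup_closure_eq {β : Type*} [CompleteLattice β] [TopologicalSpace β]
    [ClosedIicTopology β] {F : α → β} (hF : ∀ x ∈ closure s \ s, ContinuousWithinAt F s x) :
    ⨆ x ∈ closure s, F x = ⨆ x ∈ s, F x := by
  refine le_antisymm (iSup₂_le fun x hx => ?_) (biSup_mono fun x hx => subset_closure hx)
  by_cases hxs : x ∈ s
  · exact le_biSup F hxs
  have : (𝓝[s] x).NeBot := mem_closure_iff_nhdsWithin_neBot.1 hx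
  exact le_of_tendsto (hF x ⟨hx, hxs⟩) (eventually_mem_nhdsWithin.mono fun y hy => le_biSup F hy)

end Semicontinuity

section SoftMin

/-- The smooth minimum of two numbers. -/
noncomputable def softMin (a b : ℝ) : ℝ := -Real.log (Real.exp (-a) + Real.exp (-b))

/-- The inverse of `softMin · b`, which maps `ℝ` onto `Set.Iio b`; a junk value is taken at `s ≥ b`,
where the argument of the logarithm is not positive. -/
noncomputable def softMinInv (b s : ℝ) : ℝ := -Real.log (Real.exp (-s) - Real.exp (-b))

theorem exp_neg_softMin (a b : ℝ) :
    Real.exp (-softMin a b) = Real.exp (-a) + Real.exp (-b) := by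
  rw [softMin, neg_neg, Real.exp_log (by positivity)]

theorem softMin_comm (a b : ℝ) : softMin a b = softMin b a := by
  rw [softMin, softMin, add_comm]

theorem softMin_lt_left (a b : ℝ) : softMin a b < a := by
  rw [← neg_lt_neg_iff, ← Real.exp_lt_exp, exp_neg_softMin]
  exact lt_add_of_pos_right _ (Real.exp_pos _)

theorem softMin_lt_right (a b : ℝ) : softMin a b < b :=
  softMin_comm a b ▸ softMin_lt_left b a

theorem softMin_mono {a a' b b' : ℝ} (ha : a ≤ a') (hb : b ≤ b') :
    softMin a b ≤ softMin a' b' := by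
  unfold softMin
  gcongr

theorem continuous_softMin : Continuous fun q : ℝ × ℝ => softMin q.1 q.2 :=
  (Continuous.log (by fun_prop) fun q => by positivity).neg

theorem tendsto_softMin_atTop (a : ℝ) : Tendsto (softMin a) atTop (𝓝 a) := by
  have hexp : Tendsto (fun b => Real.exp (-a) + Real.exp (-b)) atTop (𝓝 (Real.exp (-a))) := by
    simpa using Real.tendsto_exp_neg_atTop_nhds_zero.const_add (Real.exp (-a))
  simpa [softMin] using! (hexp.log (Real.exp_ne_zero _)).neg

theorem softMinInv_softMin (a b : ℝ) : softMinInv b (softMin a b) = a := by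
  rw [softMinInv, exp_neg_softMin, add_sub_cancel_right, Real.log_exp, neg_neg]

theorem softMinInv_mono {b s t : ℝ} (hst : s ≤ t) (ht : t < b) :
    softMinInv b s ≤ softMinInv b t := by
  have hpos : 0 < Real.exp (-t) - Real.exp (-b) := by simpa using ht
  unfold softMinInv
  gcongr

theorem contDiffAt_softMinInv {b s : ℝ} (hs : s < b) : ContDiffAt ℝ 1 (softMinInv b) s := by
  have hne : Real.exp (-s) - Real.exp (-b) ≠ 0 := by simpa [sub_eq_zero] using hs.ne
  exact (ContDiffAt.log (f := fun t => Real.exp (-t) - Real.exp (-b)) (by fun_prop) hne).neg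

theorem hasDerivAt_softMinInv (a b : ℝ) :
    HasDerivAt (softMinInv b) (Real.sigmoid (b - a))⁻¹ (softMin a b) := by
  have hne : Real.exp (-softMin a b) - Real.exp (-b) ≠ 0 := by
    simp [exp_neg_softMin, Real.exp_ne_zero]
  refine (((hasDerivAt_neg (softMin a b)).exp.sub_const _).log hne).neg.congr_deriv ?_
  rw [exp_neg_softMin, add_sub_cancel_right, Real.sigmoid_def, inv_inv, mul_neg_one, neg_div,
    neg_neg, add_div, div_self (Real.exp_ne_zero _), ← Real.exp_sub]
  ring_nf

theorem sigmoid_sub_add_sigmoid_sub (a b : ℝ) :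
    Real.sigmoid (b - a) + Real.sigmoid (a - b) = 1 := by
  rw [← neg_sub b, Real.sigmoid_neg, add_sub_cancel]

theorem upperSemicontinuousOn_softMin {α : Type*} [TopologicalSpace α] {s : Set α} {f g : α → ℝ}
    (hf : UpperSemicontinuousOn f s) (hg : UpperSemicontinuousOn g s) :
    UpperSemicontinuousOn (fun x => softMin (f x) (g x)) s := by
  intro x hx c hc
  have hcont : Continuous fun t => softMin (f x + t) (g x + t) :=
    continuous_softMin.comp (by fun_prop : Continuous fun t : ℝ => (f x + t, g x + t))
  have hlt : ∀ᶠ t in 𝓝[>] (0 : ℝ), softMin (f x + t) (g x + t) < c :=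
    (hcont.continuousAt.eventually_lt continuousAt_const (by simpa using hc)).filter_mono
      nhdsWithin_le_nhds
  obtain ⟨t, htc, ht : 0 < t⟩ := (hlt.and self_mem_nhdsWithin).exists
  filter_upwards [hf x hx _ (lt_add_of_pos_right _ ht), hg x hx _ (lt_add_of_pos_right _ ht)]
    with y hfy hgy
  exact (softMin_mono (le_of_lt hfy) (le_of_lt hgy)).trans_lt htc

end SoftMin

section TestFunctions

theorem exists_contDiff_eventuallyEq {E F : Type*} [NormedAddCommGroup E] [NormedSpace ℝ E]
    [HasContDiffBump E] [NormedAddCommGroup F] [NormedSpace ℝ F] {k : ℕ} {φ : E → F} {x : E}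
    (hφ : ContDiffAt ℝ k φ x) : ∃ ψ : E → F, ContDiff ℝ k ψ ∧ ψ =ᶠ[𝓝 x] φ := by
  obtain ⟨r, hr, hball⟩ := Metric.nhds_basis_closedBall.mem_iff.1 (hφ.eventually (by simp))
  let χ : ContDiffBump x := ⟨r / 2, r, half_pos hr, half_lt_self hr⟩
  refine ⟨fun y => χ y • φ y, contDiff_iff_contDiffAt.2 fun y => ?_, ?_⟩
  · by_cases hy : y ∈ tsupport χ
    · exact χ.contDiffAt.smul (hball (χ.tsupport_eq ▸ hy))
    · refine (contDiffAt_const (c := (0 : F))).congr_of_eventuallyEq ?_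
      filter_upwards [notMem_tsupport_iff_eventuallyEq.1 hy] with z hz
      simp [hz]
  · filter_upwards [χ.eventuallyEq_one] with y hy
    simp [hy]

theorem hasGradientAt_mul_norm_sub_sq {E : Type*} [NormedAddCommGroup E] [InnerProductSpace ℝ E]
    [CompleteSpace E] (k : ℝ) (c x : E) :
    HasGradientAt (fun y => k * ‖y - c‖ ^ 2) ((2 * k) • (x - c)) x := by
  rw [hasGradientAt_iff_hasFDerivAt]
  refine (((hasFDerivAt_id x).sub_const c).norm_sq.const_mul k).congr_fderiv ?_
  ext y
  simp
  ring

theorem contDiff_mul_norm_sub_sq {E : Type*} [NormedAddCommGroup E] [InnerProductSpace ℝ E]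
    (k : ℝ) (c : E) : ContDiff ℝ 1 fun y => k * ‖y - c‖ ^ 2 :=
  contDiff_const.mul ((contDiff_id.sub contDiff_const).norm_sq ℝ)

end TestFunctions

section ViscositySolutions

variable {n : ℕ} {H : EuclideanSpace ℝ (Fin n) → EuclideanSpace ℝ (Fin n) → ℝ}
  {p : EuclideanSpace ℝ (Fin n)} {μ : ℝ} {U : Set (EuclideanSpace ℝ (Fin n))}
  {u w : EuclideanSpace ℝ (Fin n) → ℝ}

theorem ViscSubsol.add_const (hw : ViscSubsol H p μ U w) (C : ℝ) :
    ViscSubsol H p μ U fun x => w x + C := by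
  intro φ hφ x hx hmax
  exact hw φ hφ x hx (hmax.mono fun y hy => by linarith)

theorem ViscSubsol.mono_of_isOpen {V : Set (EuclideanSpace ℝ (Fin n))}
    (hw : ViscSubsol H p μ V w) (hUV : U ⊆ V) (hU : IsOpen U) : ViscSubsol H p μ U w := by
  intro φ hφ x hx hmax
  exact hw φ hφ x (hUV hx) ((hmax.isLocalMax (hU.mem_nhds hx)).on V)

theorem ViscSubsol.le_of_contDiffAt (hu : ViscSubsol H p μ U u)
    {φ : EuclideanSpace ℝ (Fin n) → ℝ} {x : EuclideanSpace ℝ (Fin n)} (hφ : ContDiffAt ℝ 1 φ x)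
    (hx : x ∈ U) (hmax : IsLocalMaxOn (fun y => u y - φ y) U x) :
    H (p + gradient φ x) x ≤ μ := by
  obtain ⟨ψ, hψ, hψφ⟩ := exists_contDiff_eventuallyEq (k := 1) hφ
  rw [← hψφ.gradient_eq]
  refine hu ψ hψ x hx (hmax.congr (nhdsWithin_le_nhds ?_) hx)
  filter_upwards [hψφ] with y hy
  rw [hy]

/-- Solving `softMin u b ≤ h + const` for `u` turns `h` into a test function for `u`. -/
theorem ViscSubsol.le_of_isLocalMaxOn_softMin_sub (hu : ViscSubsol H p μ U u)
    {h : EuclideanSpace ℝ (Fin n) → ℝ} {x g : EuclideanSpace ℝ (Fin n)} {b : ℝ}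
    (hh : ContDiffAt ℝ 1 h x) (hg : HasGradientAt h g x) (hx : x ∈ U)
    (hmax : IsLocalMaxOn (fun y => softMin (u y) b - h y) U x) :
    H (p + (Real.sigmoid (b - u x))⁻¹ • g) x ≤ μ := by
  let S y := softMin (u x) b + (h y - h x)
  have hSx : S x = softMin (u x) b := by simp [S]
  have hSb : S x < b := hSx ▸ softMin_lt_right _ _
  have hS : ContDiffAt ℝ 1 S x := contDiffAt_const.add (hh.sub contDiffAt_const)
  have hgrad : HasGradientAt (softMinInv b ∘ S) ((Real.sigmoid (b - u x))⁻¹ • g) x := by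
    rw [hasGradientAt_iff_hasFDerivAt, map_smul]
    exact (hSx ▸ hasDerivAt_softMinInv (u x) b).comp_hasFDerivAt x
      ((hg.hasFDerivAt.sub_const _).const_add _)
  rw [← hgrad.gradient]
  refine hu.le_of_contDiffAt ((contDiffAt_softMinInv hSb).comp x hS) hx ?_
  filter_upwards [hmax, nhdsWithin_le_nhds (hS.continuousAt.eventually_lt_const hSb)] with y hy hyb
  have huS : u y ≤ softMinInv b (S y) := by
    rw [← softMinInv_softMin (u y) b]
    exact softMinInv_mono (by linarith) hyb
  simpa [hSx, softMinInv_softMin] using huS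

end ViscositySolutions

section Hamiltonian

variable {n : ℕ} {H : EuclideanSpace ℝ (Fin n) → EuclideanSpace ℝ (Fin n) → ℝ}
  {p : EuclideanSpace ℝ (Fin n)} {μ μ' : ℝ}

theorem IsAdmissible.exists_norm_lt_of_le (hH : IsAdmissible H) (μ : ℝ) :
    ∃ R > 0, ∀ q x, H q x ≤ μ → ‖q‖ < R := by
  obtain ⟨R, hR⟩ := hH.coercive (μ + 1)
  refine ⟨max R 1, by positivity, fun q x hq => ?_⟩
  by_contra! hRq
  linarith [hR q ((le_max_left _ _).trans hRq) x]

theorem IsAdmissible.exists_forall_lt_add (hH : IsAdmissible H) (μ : ℝ) {ε : ℝ} (hε : 0 < ε) :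
    ∃ η > 0, ∀ q r x z, H q x ≤ μ → dist x z < η → ‖r‖ < η → H (q + r) z < H q x + ε := by
  obtain ⟨R, hR, hbound⟩ := hH.exists_norm_lt_of_le μ
  obtain ⟨η, hη, hunif⟩ := Metric.uniformContinuousOn_iff.1
    (hH.uniformContinuousOn (R + 1) (by positivity)) ε hε
  refine ⟨min η 1, by positivity, fun q r x z hq hxz hr => ?_⟩
  obtain ⟨hxzη, -⟩ := lt_min_iff.1 hxz
  obtain ⟨hrη, hr1⟩ := lt_min_iff.1 hr
  have hqR : ‖q‖ < R := hbound q x hq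
  have hqrR : ‖q + r‖ < R + 1 := (norm_add_le q r).trans_lt (add_lt_add hqR hr1)
  have hdist : dist (q + r, z) (q, x) < η := by
    simpa [Prod.dist_eq, dist_comm z x] using And.intro hrη hxzη
  have hlt := hunif (q + r, z) ⟨by simpa using hqrR, trivial⟩ (q, x)
    ⟨by simpa using hqR.trans (lt_add_one R), trivial⟩ hdist
  linarith [le_abs_self (H (q + r) z - H q x), Real.dist_eq (H (q + r) z) (H q x)]

theorem IsAdmissible.exists_forall_convexComb_lt (hH : IsAdmissible H) (hμ : μ' < μ) {c : ℝ}
    (hc : 0 < c) :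
    ∃ η > 0, ∀ θ₁ θ₂ : ℝ, 0 ≤ θ₁ → c ≤ θ₂ → θ₁ + θ₂ = 1 → ∀ q₁ q₂ r x y z,
      dist x z < η → dist y z < η → ‖r‖ < η → H q₁ x ≤ μ → H q₂ y ≤ μ' →
      H (θ₁ • q₁ + θ₂ • q₂ + r) z < μ := by
  obtain ⟨η, hη, hH'⟩ := hH.exists_forall_lt_add μ (mul_pos hc (sub_pos.2 hμ))
  refine ⟨η, hη, fun θ₁ θ₂ hθ₁ hcθ₂ hθ q₁ q₂ r x y z hx hy hr hq₁ hq₂ => ?_⟩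
  have hθ₂ : 0 < θ₂ := hc.trans_le hcθ₂
  have h₁ : H (q₁ + r) z ≤ μ + c * (μ - μ') := by linarith [hH' q₁ r x z hq₁ hx hr]
  have h₂ : H (q₂ + r) z < μ' + c * (μ - μ') := by linarith [hH' q₂ r y z (hq₂.trans hμ.le) hy hr]
  calc H (θ₁ • q₁ + θ₂ • q₂ + r) z
      = H (θ₁ • (q₁ + r) + θ₂ • (q₂ + r)) z := by
        rw [smul_add, smul_add, add_add_add_comm, ← add_smul, hθ, one_smul]
    _ ≤ θ₁ * H (q₁ + r) z + θ₂ * H (q₂ + r) z :=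
        (hH.convex z).2 trivial trivial hθ₁ hθ₂.le hθ
    _ < θ₁ * (μ + c * (μ - μ')) + θ₂ * (μ' + c * (μ - μ')) :=
        add_lt_add_of_le_of_lt (mul_le_mul_of_nonneg_left h₁ hθ₁) (mul_lt_mul_of_pos_left h₂ hθ₂)
    _ = μ - (θ₂ - c) * (μ - μ') := by rw [eq_sub_of_add_eq hθ]; ring
    _ ≤ μ := sub_le_self _ (mul_nonneg (sub_nonneg.2 hcθ₂) (sub_pos.2 hμ).le)

theorem IsAdmissible.viscSubsol_const (hH : IsAdmissible H) (p : EuclideanSpace ℝ (Fin n)) (a : ℝ) :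
    ∃ C, ViscSubsol H p C Set.univ fun _ => a := by
  obtain ⟨C, hC⟩ := hH.bounded (‖p‖ + 1) (by positivity)
  refine ⟨C, fun φ _ x _ hmax => ?_⟩
  have hmin : IsLocalMin φ x := by
    filter_upwards [hmax.isLocalMax univ_mem] with y hy using (sub_le_sub_iff_left a).1 hy
  have hgrad : gradient φ x = 0 := by simp [gradient, hmin.fderiv_eq_zero]
  rw [hgrad, add_zero]
  exact (abs_le.1 (hC p (by simp) x)).2

theorem IsAdmissible.exists_strict_viscSubsol (hH : IsAdmissible H) (hμ : effectiveH H p < μ) :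
    ∃ μ' < μ, ∃ w : EuclideanSpace ℝ (Fin n) → ℝ, Continuous w ∧ ViscSubsol H p μ' Set.univ w ∧
      Tendsto (fun y => w y / ‖y‖) (cobounded (EuclideanSpace ℝ (Fin n))) (𝓝 0) := by
  obtain ⟨C, hC⟩ := hH.viscSubsol_const p 0
  unfold effectiveH at hμ
  obtain ⟨μ', ⟨w, ⟨K, hK⟩, hw, hlim⟩, hμ'⟩ := exists_lt_of_csInf_lt
    (by exact ⟨C, fun _ => 0, ⟨0, LipschitzWith.const 0⟩, hC, by
      simpa only [zero_div] using tendsto_const_nhds⟩) hμ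
  exact ⟨μ', hμ', w, hK.continuous, hw, hlim⟩

end Hamiltonian

section Growth

variable {E : Type*} [NormedAddCommGroup E] {l : Filter E} {v w : E → ℝ}

theorem exists_pos_eventually_mul_norm_lt (hl : l ≤ cobounded E)
    (hv : 0 < liminf (fun x => ((v x / ‖x‖ : ℝ) : EReal)) l) :
    ∃ c > 0, ∀ᶠ x in l, c * ‖x‖ < v x := by
  obtain ⟨c, hc, hcv⟩ := EReal.lt_iff_exists_real_btwn.1 hv
  refine ⟨c, by exact_mod_cast hc, ?_⟩
  filter_upwards [eventually_lt_of_lt_liminf hcv, hl (eventually_cobounded_le_norm 1)]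
    with x hx hx1
  exact (lt_div_iff₀ (zero_lt_one.trans_le hx1)).1 (by exact_mod_cast hx)

theorem tendsto_sub_atBot_of_liminf_pos (hl : l ≤ cobounded E)
    (hw : Tendsto (fun x => w x / ‖x‖) l (𝓝 0))
    (hv : 0 < liminf (fun x => ((v x / ‖x‖ : ℝ) : EReal)) l) :
    Tendsto (fun x => w x - v x) l atBot := by
  obtain ⟨c, hc, hcv⟩ := exists_pos_eventually_mul_norm_lt hl hv
  refine tendsto_atBot_mono' l ?_
    ((tendsto_norm_cobounded_atTop.mono_left hl).const_mul_atTop_of_neg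
      (neg_lt_zero.2 (half_pos hc)))
  filter_upwards [hcv, hl (eventually_cobounded_le_norm 1), hw.eventually_lt_const (half_pos hc)]
    with x hvx hx1 hwx
  linarith [(div_lt_iff₀ (zero_lt_one.trans_le hx1)).1 hwx]

end Growth

section Tripling

/-- The functional of the tripling of variables, a function of `X = (x, y, z)` in which
`softMin (u x) (w y) - v z` is penalized by the distances of `x` and `y` from `z`, with the large
factor `k`, and of `z` from `x₀`, which makes the maximum at `x₀` strict. -/
noncomputable def tripledFunctional {E : Type*} [NormedAddCommGroup E] (u w v : E → ℝ) (x₀ : E)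
    (k : ℝ) (X : E × E × E) : ℝ :=
  softMin (u X.1) (w X.2.1) - (v X.2.2 + ‖X.2.2 - x₀‖ ^ 2) -
    k * (‖X.1 - X.2.2‖ ^ 2 + ‖X.2.1 - X.2.2‖ ^ 2)

variable {E : Type*} [NormedAddCommGroup E] {U N : Set E} {u w v : E → ℝ} {x₀ : E}

theorem tripledFunctional_zero_lt (hmax : IsMaxOn (fun x => softMin (u x) (w x) - v x) U x₀)
    {X : E × E × E} (hX : X.1 ∈ U) (hQ : ‖X.1 - X.2.2‖ ^ 2 + ‖X.2.1 - X.2.2‖ ^ 2 = 0)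
    (hne : X ≠ (x₀, x₀, x₀)) :
    tripledFunctional u w v x₀ 0 X < softMin (u x₀) (w x₀) - v x₀ := by
  obtain ⟨x, y, z⟩ := X
  obtain ⟨hxz, hyz⟩ := (add_eq_zero_iff_of_nonneg (sq_nonneg _) (sq_nonneg _)).1 hQ
  obtain rfl : x = z := by simpa [sub_eq_zero] using hxz
  obtain rfl : y = x := by simpa [sub_eq_zero] using hyz
  have hy : 0 < ‖y - x₀‖ := norm_sub_pos_iff.2 fun h => hne (by rw [h])
  have hle : softMin (u y) (w y) - v y ≤ softMin (u x₀) (w x₀) - v x₀ := hmax hX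
  simp only [tripledFunctional, zero_mul, sub_zero]
  linarith [pow_pos hy 2]

theorem upperSemicontinuousOn_tripledFunctional_zero (hu : UpperSemicontinuousOn u U)
    (hw : UpperSemicontinuousOn w U) (hv : LowerSemicontinuousOn v U) :
    UpperSemicontinuousOn (tripledFunctional u w v x₀ 0) (U ×ˢ U ×ˢ U) := by
  unfold tripledFunctional
  simp only [zero_mul, sub_zero]
  refine upperSemicontinuousOn_sub (upperSemicontinuousOn_softMin ?_ ?_) (.add ?_ ?_)
  · exact UpperSemicontinuousOn.comp hu continuous_fst.continuousOn fun X hX => hX.1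
  · exact UpperSemicontinuousOn.comp hw (by fun_prop) fun X hX => hX.2.1
  · exact LowerSemicontinuousOn.comp hv (by fun_prop) fun X hX => hX.2.2
  · exact (by fun_prop : Continuous _).lowerSemicontinuous.lowerSemicontinuousOn _

theorem exists_isLocalMax_tripledFunctional [ProperSpace E] (hU : U ∈ 𝓝 x₀)
    (hu : UpperSemicontinuousOn u U) (hw : UpperSemicontinuousOn w U)
    (hv : LowerSemicontinuousOn v U)
    (hmax : IsMaxOn (fun x => softMin (u x) (w x) - v x) U x₀) (hN : N ∈ 𝓝 x₀) :
    ∃ k, ∃ x ∈ N, ∃ y ∈ N, ∃ z ∈ N,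
      softMin (u x₀) (w x₀) - v x₀ ≤ softMin (u x) (w y) - v z ∧
      IsLocalMax (tripledFunctional u w v x₀ k) (x, y, z) := by
  obtain ⟨B, hB, hBU, hBc⟩ := local_compact_nhds hU
  obtain ⟨V, hVN, hV, hx₀V⟩ := mem_nhds_iff.1 (inter_mem hN hB)
  let Q : E × E × E → ℝ := fun X => ‖X.1 - X.2.2‖ ^ 2 + ‖X.2.1 - X.2.2‖ ^ 2
  have hQ : Continuous Q := by fun_prop
  have hK : IsCompact (B ×ˢ B ×ˢ B) := hBc.prod (hBc.prod hBc)
  have hVo : IsOpen (V ×ˢ V ×ˢ V) := hV.prod (hV.prod hV)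
  have hVK : V ×ˢ V ×ˢ V ⊆ B ×ˢ B ×ˢ B := fun X hX =>
    ⟨(hVN hX.1).2, (hVN hX.2.1).2, (hVN hX.2.2).2⟩
  have husc : UpperSemicontinuousOn (tripledFunctional u w v x₀ 0) (B ×ˢ B ×ˢ B) :=
    upperSemicontinuousOn_tripledFunctional_zero (hu.mono hBU) (hw.mono hBU) (hv.mono hBU)
  have hsplit : ∀ k, tripledFunctional u w v x₀ k =
      fun X => tripledFunctional u w v x₀ 0 X - k * Q X := fun k => by
    simp [funext_iff, tripledFunctional, Q]
  have hx₀ : ((x₀, x₀, x₀) : E × E × E) ∈ V ×ˢ V ×ˢ V := ⟨hx₀V, hx₀V, hx₀V⟩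
  obtain ⟨k, hlt, hk⟩ := ((eventually_forall_sub_mul_lt (hK.diff hVo) (husc.mono Set.sdiff_subset)
    (hQ.lowerSemicontinuous.lowerSemicontinuousOn _) (fun X _ => by positivity)
    fun X hX hQX => tripledFunctional_zero_lt hmax (hBU hX.1.1) hQX
      fun h => hX.2 (h ▸ hx₀)).and (eventually_ge_atTop 0)).exists
  have husck : UpperSemicontinuousOn (tripledFunctional u w v x₀ k) (B ×ˢ B ×ˢ B) := by
    rw [hsplit k]
    exact upperSemicontinuousOn_sub husc
      ((hQ.const_mul k).lowerSemicontinuous.lowerSemicontinuousOn _)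
  obtain ⟨⟨x, y, z⟩, hX, hXmax⟩ := husck.exists_isMaxOn ⟨_, hVK hx₀⟩ hK
  have hval : softMin (u x₀) (w x₀) - v x₀ ≤ tripledFunctional u w v x₀ k (x, y, z) := by
    simpa [tripledFunctional] using hXmax (hVK hx₀)
  have hXV : (x, y, z) ∈ V ×ˢ V ×ˢ V := by
    by_contra hXV
    exact (hlt _ ⟨hX, hXV⟩).not_ge (by simpa [hsplit k] using hval)
  refine ⟨k, x, (hVN hXV.1).1, y, (hVN hXV.2.1).1, z, (hVN hXV.2.2).1, ?_,
    hXmax.isLocalMax (mem_of_superset (hVo.mem_nhds hXV) hVK)⟩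
  have hkQ : 0 ≤ k * Q (x, y, z) := by positivity
  simp only [tripledFunctional, Q] at hval hkQ
  linarith [sq_nonneg ‖z - x₀‖]

end Tripling

section Comparison

variable {n : ℕ} {H : EuclideanSpace ℝ (Fin n) → EuclideanSpace ℝ (Fin n) → ℝ}
  {p : EuclideanSpace ℝ (Fin n)} {μ μ' : ℝ} {U : Set (EuclideanSpace ℝ (Fin n))}
  {u w v : EuclideanSpace ℝ (Fin n) → ℝ}

theorem ViscSubsol.le_of_isLocalMaxOn_softMin_sub_norm_sq (hu : ViscSubsol H p μ U u) {b k : ℝ}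
    {x z : EuclideanSpace ℝ (Fin n)} (hx : x ∈ U)
    (hmax : IsLocalMaxOn (fun e => softMin (u e) b - k * ‖e - z‖ ^ 2) U x) :
    H (p + (Real.sigmoid (b - u x))⁻¹ • (2 * k) • (x - z)) x ≤ μ :=
  hu.le_of_isLocalMaxOn_softMin_sub (contDiff_mul_norm_sub_sq k z).contDiffAt
    (hasGradientAt_mul_norm_sub_sq k z x) hx hmax

theorem ViscSupersol.le_of_isLocalMinOn_add_norm_sq (hv : ViscSupersol H p μ U v) {k : ℝ}
    {x y z x₀ : EuclideanSpace ℝ (Fin n)} (hz : z ∈ U)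
    (hmin : IsLocalMinOn (fun e => v e + ‖e - x₀‖ ^ 2 + k * (‖x - e‖ ^ 2 + ‖y - e‖ ^ 2)) U z) :
    μ ≤ H (p + ((2 * k) • (x - z) + (2 * k) • (y - z) + (2 : ℝ) • (x₀ - z))) z := by
  let φ e := -(k * ‖e - x‖ ^ 2 + k * ‖e - y‖ ^ 2 + 1 * ‖e - x₀‖ ^ 2)
  have hφ : ContDiff ℝ 1 φ := (((contDiff_mul_norm_sub_sq k x).add
    (contDiff_mul_norm_sub_sq k y)).add (contDiff_mul_norm_sub_sq 1 x₀)).neg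
  have hgrad : HasGradientAt φ
      ((2 * k) • (x - z) + (2 * k) • (y - z) + (2 : ℝ) • (x₀ - z)) z := by
    rw [hasGradientAt_iff_hasFDerivAt]
    refine (((hasGradientAt_mul_norm_sub_sq k x z).hasFDerivAt.add
      (hasGradientAt_mul_norm_sub_sq k y z).hasFDerivAt).add
      (hasGradientAt_mul_norm_sub_sq 1 x₀ z).hasFDerivAt).neg.congr_fderiv ?_
    rw [← map_add, ← map_add, ← map_neg]
    congr 1
    module
  rw [← hgrad.gradient]
  refine hv φ hφ z hz (hmin.mono fun e he => ?_)
  simp only [φ, norm_sub_rev _ x, norm_sub_rev _ y]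
  linarith

theorem exists_le_of_isLocalMax_tripledFunctional (husub : ViscSubsol H p μ U u)
    (hwsub : ViscSubsol H p μ' U w) (hvsuper : ViscSupersol H p μ U v) {k : ℝ}
    {x₀ x y z : EuclideanSpace ℝ (Fin n)} (hx : x ∈ U) (hy : y ∈ U) (hz : z ∈ U)
    (hmax : IsLocalMax (tripledFunctional u w v x₀ k) (x, y, z)) :
    ∃ q₁ q₂, H q₁ x ≤ μ ∧ H q₂ y ≤ μ' ∧
      μ ≤ H (Real.sigmoid (w y - u x) • q₁ + Real.sigmoid (u x - w y) • q₂ +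
        (2 : ℝ) • (x₀ - z)) z := by
  have hxmax : IsLocalMax (fun e => tripledFunctional u w v x₀ k (e, y, z)) x :=
    hmax.comp_continuous (g := fun e => (e, y, z)) (by fun_prop)
  have hymax : IsLocalMax (fun e => tripledFunctional u w v x₀ k (x, e, z)) y :=
    hmax.comp_continuous (g := fun e => (x, e, z)) (by fun_prop)
  have hzmax : IsLocalMax (fun e => tripledFunctional u w v x₀ k (x, y, e)) z :=
    hmax.comp_continuous (g := fun e => (x, y, e)) (by fun_prop)
  simp only [tripledFunctional] at hxmax hymax hzmax
  simp only [softMin_comm (u x)] at hymax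
  refine ⟨_, _, husub.le_of_isLocalMaxOn_softMin_sub_norm_sq (k := k) (z := z) hx
    ((hxmax.on U).mono fun e he => by linarith),
    hwsub.le_of_isLocalMaxOn_softMin_sub_norm_sq (b := u x) (k := k) (z := z) hy
    ((hymax.on U).mono fun e he => by linarith), ?_⟩
  have hz' := hvsuper.le_of_isLocalMinOn_add_norm_sq (k := k) (x := x) (y := y) (x₀ := x₀) hz
    ((hzmax.on U).mono fun e he => by linarith)
  convert hz' using 1
  rw [smul_add, smul_add, smul_inv_smul₀ (Real.sigmoid_pos _).ne',
    smul_inv_smul₀ (Real.sigmoid_pos _).ne', add_add_add_comm, ← add_smul,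
    sigmoid_sub_add_sigmoid_sub, one_smul, add_assoc]

theorem not_isMaxOn_softMin_sub (hH : IsAdmissible H) (hμ : μ' < μ) (hU : IsOpen U)
    (hu : UpperSemicontinuousOn u U) (hw : UpperSemicontinuousOn w U)
    (hv : LowerSemicontinuousOn v U) (husub : ViscSubsol H p μ U u)
    (hwsub : ViscSubsol H p μ' U w) (hvsuper : ViscSupersol H p μ U v)
    {x₀ : EuclideanSpace ℝ (Fin n)} (hx₀ : x₀ ∈ U) :
    ¬ IsMaxOn (fun x => softMin (u x) (w x) - v x) U x₀ := by
  intro hmax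
  obtain ⟨η, hη, hconv⟩ := hH.exists_forall_convexComb_lt hμ
    (Real.sigmoid_pos (softMin (u x₀) (w x₀) - w x₀ - 2))
  have hwN : ∀ᶠ x in 𝓝 x₀, w x < w x₀ + 1 :=
    hU.nhdsWithin_eq hx₀ ▸ hw x₀ hx₀ _ (lt_add_one _)
  have hvN : ∀ᶠ x in 𝓝 x₀, v x₀ - 1 < v x :=
    hU.nhdsWithin_eq hx₀ ▸ hv x₀ hx₀ _ (sub_one_lt _)
  have hN : {x | dist x x₀ < η / 2 ∧ x ∈ U ∧ w x < w x₀ + 1 ∧ v x₀ - 1 < v x} ∈ 𝓝 x₀ :=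
    inter_mem (Metric.ball_mem_nhds x₀ (half_pos hη))
      (inter_mem (hU.mem_nhds hx₀) (inter_mem hwN hvN))
  obtain ⟨k, x, ⟨hxη, hxU, -⟩, y, ⟨hyη, hyU, hwy, -⟩, z, ⟨hzη, hzU, -, hvz⟩, hval, hloc⟩ :=
    exists_isLocalMax_tripledFunctional (hU.mem_nhds hx₀) hu hw hv hmax hN
  obtain ⟨q₁, q₂, hq₁, hq₂, hz⟩ :=
    exists_le_of_isLocalMax_tripledFunctional husub hwsub hvsuper hxU hyU hzU hloc
  have hweight : Real.sigmoid (softMin (u x₀) (w x₀) - w x₀ - 2) ≤ Real.sigmoid (u x - w y) :=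
    Real.sigmoid_le (by linarith [softMin_lt_left (u x) (w y)])
  have hr : ‖(2 : ℝ) • (x₀ - z)‖ < η := by
    rw [norm_smul, ← dist_eq_norm, dist_comm, Real.norm_ofNat]
    linarith
  exact hz.not_gt (hconv _ _ (Real.sigmoid_pos _).le hweight
    (sigmoid_sub_add_sigmoid_sub _ _) q₁ q₂ _ x y z
    ((dist_triangle_right x z x₀).trans_lt (by linarith))
    ((dist_triangle_right y z x₀).trans_lt (by linarith)) hr hq₁ hq₂)

theorem softMin_sub_le_of_forall_frontier (hH : IsAdmissible H) (hμ : μ' < μ) (hU : IsOpen U)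
    (hu : UpperSemicontinuousOn u (closure U)) (hw : UpperSemicontinuousOn w (closure U))
    (hv : LowerSemicontinuousOn v (closure U)) (husub : ViscSubsol H p μ U u)
    (hwsub : ViscSubsol H p μ' U w) (hvsuper : ViscSupersol H p μ U v)
    (hwv : Tendsto (fun x => w x - v x) (cobounded _ ⊓ 𝓟 U) atBot) {M : ℝ}
    (hM : ∀ x ∈ frontier U, u x - v x ≤ M) {x : EuclideanSpace ℝ (Fin n)} (hx : x ∈ closure U) :
    softMin (u x) (w x) - v x ≤ M := by
  have hfrontier : ∀ y ∈ frontier U, softMin (u y) (w y) - v y ≤ M := fun y hy =>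
    (sub_le_sub_right (softMin_lt_left _ _).le _).trans (hM y hy)
  by_contra! hlt
  have hfar : ∀ᶠ y in cocompact _ ⊓ 𝓟 (closure U),
      softMin (u y) (w y) - v y ≤ softMin (u x) (w x) - v x := by
    rw [← Metric.cobounded_eq_cocompact, eventually_inf_principal]
    filter_upwards [eventually_inf_principal.1 (hwv.eventually_le_atBot _)] with y hfarU hy
    by_cases hyU : y ∈ U
    · exact (sub_le_sub_right (softMin_lt_right _ _).le _).trans (hfarU hyU)
    · exact (hfrontier y (hU.frontier_eq ▸ ⟨hy, hyU⟩)).trans hlt.le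
  obtain ⟨x₀, hx₀, hmax⟩ := exists_isMaxOn_of_eventually_le
    (upperSemicontinuousOn_sub (upperSemicontinuousOn_softMin hu hw) hv) isClosed_closure hx hfar
  have hx₀U : x₀ ∈ U := by
    by_contra hx₀U
    exact (hlt.trans_le (hmax hx)).not_ge (hfrontier x₀ (hU.frontier_eq ▸ ⟨hx₀, hx₀U⟩))
  exact not_isMaxOn_softMin_sub hH hμ hU (hu.mono subset_closure) (hw.mono subset_closure)
    (hv.mono subset_closure) husub hwsub hvsuper hx₀U (hmax.on_subset subset_closure)

theorem sub_le_of_forall_frontier (hH : IsAdmissible H) (hμ : effectiveH H p < μ) (hU : IsOpen U)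
    (hu : UpperSemicontinuousOn u (closure U)) (hv : LowerSemicontinuousOn v (closure U))
    (husub : ViscSubsol H p μ U u) (hvsuper : ViscSupersol H p μ U v)
    (hvgrowth : 0 < liminf (fun x => ((v x / ‖x‖ : ℝ) : EReal)) (cobounded _ ⊓ 𝓟 U)) {M : ℝ}
    (hM : ∀ x ∈ frontier U, u x - v x ≤ M) {x : EuclideanSpace ℝ (Fin n)} (hx : x ∈ closure U) :
    u x - v x ≤ M := by
  obtain ⟨μ', hμ', w, hwcont, hwsub, hwlim⟩ := hH.exists_strict_viscSubsol hμ
  have hwv : Tendsto (fun x => w x - v x) (cobounded _ ⊓ 𝓟 U) atBot :=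
    tendsto_sub_atBot_of_liminf_pos inf_le_left (hwlim.mono_left inf_le_left) hvgrowth
  have hC : ∀ C, softMin (u x) (w x + C) - v x ≤ M := fun C =>
    softMin_sub_le_of_forall_frontier hH hμ' hU hu
      ((hwcont.add_const C).upperSemicontinuous.upperSemicontinuousOn _) hv husub
      ((hwsub.mono_of_isOpen (Set.subset_univ U) hU).add_const C) hvsuper
      (by simpa only [add_sub_right_comm] using tendsto_atBot_add_const_right _ C hwv) hM hx
  have hlim : Tendsto (fun C => softMin (u x) (w x + C)) atTop (𝓝 (u x)) :=
    (tendsto_softMin_atTop (u x)).comp (tendsto_atTop_add_const_left _ (w x) tendsto_id)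
  exact le_of_tendsto' (hlim.sub_const (v x)) hC

end Comparison

end Eikonal

theorem proposition6p1_general (n : ℕ)
    (H : EuclideanSpace ℝ (Fin n) → EuclideanSpace ℝ (Fin n) → ℝ)
    (hH : Eikonal.IsAdmissible H)
    (p : EuclideanSpace ℝ (Fin n)) (μ : ℝ) (hμ : Eikonal.effectiveH H p < μ)
    (D : Set (EuclideanSpace ℝ (Fin n))) (hD : IsClosed D)
    (u v : EuclideanSpace ℝ (Fin n) → ℝ)
    (hu : UpperSemicontinuousOn u (closure Dᶜ))
    (hv : LowerSemicontinuousOn v (closure Dᶜ))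
    (husub : Eikonal.ViscSubsol H p μ Dᶜ u)
    (hvsuper : Eikonal.ViscSupersol H p μ Dᶜ v)
    (hvgrowth : 0 < liminf (fun x => ((v x / ‖x‖ : ℝ) : EReal))
      (cobounded (EuclideanSpace ℝ (Fin n)) ⊓ 𝓟 Dᶜ)) :
    ((⨆ x ∈ closure Dᶜ, ((u x - v x : ℝ) : EReal)) =
        ⨆ x ∈ frontier D, ((u x - v x : ℝ) : EReal)) ∧
      ((∀ x ∈ frontier D, ContinuousWithinAt (fun y => u y - v y) Dᶜ x) →
        (⨆ x ∈ Dᶜ, ((u x - v x : ℝ) : EReal)) =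
          ⨆ x ∈ frontier D, ((u x - v x : ℝ) : EReal)) := by
  rw [← frontier_compl D]
  have heq : (⨆ x ∈ closure Dᶜ, ((u x - v x : ℝ) : EReal)) =
      ⨆ x ∈ frontier Dᶜ, ((u x - v x : ℝ) : EReal) := by
    refine le_antisymm (EReal.le_of_forall_lt_iff_le.1 fun M hM => iSup₂_le fun x hx => ?_)
      (biSup_mono fun x hx => frontier_subset_closure hx)
    have hfrontier : ∀ y ∈ frontier Dᶜ, u y - v y ≤ M := fun y hy =>
      EReal.coe_le_coe_iff.1 ((le_biSup (fun y => ((u y - v y : ℝ) : EReal)) hy).trans hM.le)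
    exact EReal.coe_le_coe_iff.2 (Eikonal.sub_le_of_forall_frontier hH hμ hD.isOpen_compl hu hv
      husub hvsuper hvgrowth hfrontier hx)
  refine ⟨heq, fun hcont => ?_⟩
  rw [← heq, Eikonal.biSup_closure_eq]
  rw [← hD.isOpen_compl.frontier_eq]
  exact fun x hx => (continuous_coe_real_ereal.tendsto _).comp (hcont x hx)

theorem proposition6p1 (n : ℕ) (hn : 1 ≤ n)
    (H : EuclideanSpace ℝ (Fin n) → EuclideanSpace ℝ (Fin n) → ℝ)
    (hH : Eikonal.IsAdmissible H)
    (p : EuclideanSpace ℝ (Fin n)) (μ : ℝ) (hμ : Eikonal.effectiveH H p < μ)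
    (D : Set (EuclideanSpace ℝ (Fin n))) (hD : IsCompact D)
    (u v : EuclideanSpace ℝ (Fin n) → ℝ)
    (hu : UpperSemicontinuousOn u (closure Dᶜ))
    (hv : LowerSemicontinuousOn v (closure Dᶜ))
    (husub : Eikonal.ViscSubsol H p μ Dᶜ u)
    (hvsuper : Eikonal.ViscSupersol H p μ Dᶜ v)
    (hvgrowth : 0 < liminf (fun x => ((v x / ‖x‖ : ℝ) : EReal))
      (cobounded (EuclideanSpace ℝ (Fin n))))
    (hugrowth : limsup (fun x => ((u x / ‖x‖ : ℝ) : EReal))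
      (cobounded (EuclideanSpace ℝ (Fin n))) < ⊤) :
    ((⨆ x ∈ closure Dᶜ, ((u x - v x : ℝ) : EReal)) =
        ⨆ x ∈ frontier D, ((u x - v x : ℝ) : EReal)) ∧
      ((∀ x ∈ frontier D, ContinuousWithinAt (fun y => u y - v y) Dᶜ x) →
        (⨆ x ∈ Dᶜ, ((u x - v x : ℝ) : EReal)) =
          ⨆ x ∈ frontier D, ((u x - v x : ℝ) : EReal)) := by
  refine proposition6p1_general n H hH p μ hμ D hD.isClosed u v hu hv husub hvsuper ?_
  exact hvgrowth.trans_le (liminf_le_liminf_of_le inf_le_left)
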